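/- Let $q$ be a prime power. An $[[n,k,d;c]]_q$ entanglement-assisted quantum (QUENTA) code encodes $k$ logical qudits (each of dimension $q$) into $n$ physical qudits with the help of $c$ copies of the maximally entangled state $q^{-1/2}\sum_a |a\rangle|a\rangle$, the receiver's halves of which are free of errors, and has minimum distance $d$: it detects all errors on fewer than $d$ physical qudits and corrects arbitrary errors on up to $\lfloor (d-1)/2\rfloor$ physical qudits. Write $[[n,k,\geq d;c]]_q$ if the minimum distance is at least $d$. Let $P_0$ and $P_\infty$ be the zero and the pole of $z$ in the rational function field $\mathbb{F}_q(z)$, let $P_1,\dots,P_{q-1}$ be the other rational places, in any order, and let $D=P_1+\cdots+P_{q-1}$. For a divisor $G$ with support disjoint from that of $D$ put $C_{\mathcal L}(D,G)=\{(f(P_1),\dots,f(P_{q-1})) : f\in\mathcal L(G)\}\subseteq\mathbb{F}_q^{q-1}$, where $\mathcal L(G)=\{f : f=0 \text{ or } (f)\ge -G\}$. Let $a_1,a_2,b_1,b_2$ be positive integers with $b_1\le a_2$, $b_2\le q-2-a_2$, $a_1+a_2<q-1$ and $b_1+b_2<q-1$. Put $G_1=a_1P_0+a_2P_\infty$, $G_2=b_1P_0+b_2P_\infty$,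 $C_1=C_{\mathcal L}(D,G_1)$ and $C_2=C_{\mathcal L}(D,G_2)$. 1. If $b_2\ge a_1+1$, then there exists a QUENTA code with parameters $$[[\,q-1,\ a_1+b_1+1,\ \ge q-1-\max\{a_1+a_2,\,b_1+b_2\};\ q-2-(a_2+b_2)\,]]_q .$$ 2. If $b_2<a_1+1$, then there exists a QUENTA code with parameters $$[[\,q-1,\ b_1+b_2+1,\ \ge q-1-\max\{a_1+a_2,\,b_1+b_2\};\ q-2-(a_1+a_2)\,]]_q .$$ In both cases the code can be taken to be the entanglement-assisted stabilizer code of the Euclidean construction from $C_1$ and $C_2$: its code states are fixed by the shift operators $X(u)$, $u\in C_1^\perp$, and the phase operators $Z(v)$, $v\in C_2^\perp$, on the physical qudits, each extended by a suitable shift or phase operator, respectively, on the receiver's qudits, and its number $k$ of logical qudits and $c$ of entangled pairs satisfy $k=\dim C_1+\dim C_2-(q-1)+c$ and $c=\dim C_1^\perp-\dim(C_1^\perp\cap C_2)$. -/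

import Mathlib

open Polynomial IsDedekindDomain
open scoped Kronecker Matrix

noncomputable section

/-! ### Two-point codes on the rational function field -/

namespace RationalAG

variable {F : Type*} [Field F]

/-- Places of `F(z)/F`: `some p` is the place of a nonzero prime ideal `p` of `F[z]`, and `none` is
the place at infinity. -/
abbrev Place (F : Type*) [Field F] := Option (HeightOneSpectrum F[X])

open Classical in
/-- The valuation at a place, written multiplicatively: `val P f = exp (-ν_P f)` for `f ≠ 0`. -/
def val : Place F → Valuation (RatFunc F) (WithZero (Multiplicative ℤ))
  | some p => p.valuation (RatFunc F)
  | none => RatFunc.inftyValuation F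

/-- The rational place `z = α`, i.e. the prime ideal `(z - α)`. -/
def finitePlace (α : F) : Place F :=
  some
    { asIdeal := Ideal.span {X - C α}
      isPrime := (Ideal.span_singleton_prime (X_sub_C_ne_zero α)).2 (prime_X_sub_C α)
      ne_bot := by
        rw [ne_eq, Ideal.span_singleton_eq_bot]
        exact X_sub_C_ne_zero α }

/-- The place at infinity. -/
def inftyPlace : Place F := none

theorem val_C_le_one (P : Place F) (a : F) : val P (RatFunc.C a) ≤ 1 := by
  classical
  cases P with
  | some p =>
    rw [val, ← RatFunc.algebraMap_C]
    exact p.valuation_le_one (C a)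
  | none =>
    rcases eq_or_ne a 0 with rfl | h
    · simp
    · rw [val]
      exact (RatFunc.inftyValuation.C F h).le

/-- Divisors: finitely supported formal sums of places. -/
abbrev Divisor (F : Type*) [Field F] := Place F →₀ ℤ

/-- The Riemann–Roch space `L(G) = {f | f = 0 or (f) ≥ -G}`. The condition `ν_P f ≥ -G(P)` reads
`val P f ≤ exp (G P)`. -/
def riemannRoch (G : Divisor F) : Submodule F (RatFunc F) where
  carrier := {f | ∀ P, val P f ≤ WithZero.exp (G P)}
  zero_mem' := fun P => by simp
  add_mem' := fun hf hg P => (val P).map_add_le (hf P) (hg P)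
  smul_mem' := fun a f hf P => by
    rw [RatFunc.smul_eq_C_mul, map_mul]
    exact (mul_le_mul' (val_C_le_one P a) (hf P)).trans (one_mul _).le

/-- The code `C_L(D, G)` for `D = P₁ + ⋯ + Pₙ`, where `Pᵢ` is the rational place `z = P i`: all words
`(f(P₁), …, f(Pₙ))` with `f ∈ L(G)`. That the residue class `f(Pᵢ)` equals `c i ∈ F` is expressed as
`f ≡ c i` modulo the maximal ideal `Pᵢ`, that is, `ν_{Pᵢ}(f - c i) > 0`. -/
def agCode {n : ℕ} (P : Fin n → F) (G : Divisor F) : Submodule F (Fin n → F) where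
  carrier := {c | ∃ f ∈ riemannRoch G, ∀ i, val (finitePlace (P i)) (f - RatFunc.C (c i)) < 1}
  zero_mem' := ⟨0, zero_mem _, fun i => by simp⟩
  add_mem' := by
    rintro c c' ⟨f, hf, h⟩ ⟨f', hf', h'⟩
    refine ⟨f + f', add_mem hf hf', fun i => ?_⟩
    have e : f + f' - RatFunc.C ((c + c') i)
        = (f - RatFunc.C (c i)) + (f' - RatFunc.C (c' i)) := by
      rw [Pi.add_apply, map_add]; ring
    rw [e]
    exact (val _).map_add_lt (h i) (h' i)
  smul_mem' := by
    rintro a c ⟨f, hf, h⟩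
    refine ⟨a • f, Submodule.smul_mem _ a hf, fun i => ?_⟩
    have e : a • f - RatFunc.C ((a • c) i) = RatFunc.C a * (f - RatFunc.C (c i)) := by
      rw [RatFunc.smul_eq_C_mul, Pi.smul_apply, smul_eq_mul, map_mul]; ring
    rw [e, map_mul]
    exact (mul_le_mul' (val_C_le_one _ a) le_rfl).trans_lt ((one_mul _).trans_lt (h i))

/-- The two-point divisor `a P₀ + b P_∞`. -/
def twoPoint (a b : ℤ) : Divisor F :=
  Finsupp.single (finitePlace 0) a + Finsupp.single inftyPlace b

/-- The Euclidean dual of a linear code. -/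
def dual {n : ℕ} (C : Submodule F (Fin n → F)) : Submodule F (Fin n → F) where
  carrier := {x | ∀ c ∈ C, x ⬝ᵥ c = 0}
  zero_mem' := fun c _ => zero_dotProduct c
  add_mem' := fun hx hy c hc => by rw [add_dotProduct, hx c hc, hy c hc, add_zero]
  smul_mem' := fun a x hx c hc => by rw [smul_dotProduct, hx c hc, smul_zero]

end RationalAG

/-! ### Entanglement-assisted quantum codes

A qudit has an orthonormal basis labelled by a finite alphabet `A` (so its dimension is `q = |A|`),
and `m` qudits have the orthonormal basis `Fin m → A`. Operators are matrices in these bases. -/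

namespace Quenta

variable {A : Type*} [Fintype A] [DecidableEq A]

/-- Operators on `m` qudits. -/
abbrev Op (A : Type*) (m : ℕ) := Matrix (Fin m → A) (Fin m → A) ℂ

/-- The joint state space of the `n` physical qudits and of the receiver's `c` qudits. -/
abbrev Joint (A : Type*) (n c : ℕ) := (Fin n → A) × (Fin c → A)

/-- The coefficient of `|y⟩ ⊗ |y'⟩` in `c` copies of the maximally entangled state
`q^{-1/2} ∑ₐ |a⟩ ⊗ |a⟩`. -/
def maxEntangled {c : ℕ} (y y' : Fin c → A) : ℂ :=
  if y = y' then (((Real.sqrt (Fintype.card A : ℝ)) ^ c)⁻¹ : ℝ) else 0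

/-- An entanglement-assisted encoder of `k` logical qudits into `n` physical qudits with `c` copies of
the maximally entangled state: an isometry from the `k` logical qudits together with the sender's `c`
halves to the `n` physical qudits (a unitary acting after ancillas have been appended). -/
structure Code (A : Type*) [Fintype A] [DecidableEq A] (n k c : ℕ) where
  /-- The encoding isometry. -/
  enc : Matrix (Fin n → A) ((Fin k → A) × (Fin c → A)) ℂ
  isometry : encᴴ * enc = 1

variable {n k c : ℕ}

/-- The map `|ψ⟩ ↦ (enc ⊗ I)(|ψ⟩ ⊗ |Φ⟩^{⊗ c})`, whose range is the quantum code. -/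
def Code.encode (Q : Code A n k c) : Matrix (Joint A n c) (Fin k → A) ℂ :=
  Matrix.of fun s x => ∑ y, Q.enc s.1 (x, y) * maxEntangled y s.2

/-- `E` acts only on the qudits in `T`: it is an operator on them tensored with the identity. -/
def ActsOn (T : Finset (Fin n)) (E : Op A n) : Prop :=
  ∃ e : Matrix (T → A) (T → A) ℂ, ∀ x y,
    E x y = if ∀ i, i ∉ T → x i = y i then e (fun i => x i) (fun i => y i) else 0

/-- The linear span of the errors that act on at most `t` qudits. -/
def errorSpace (A : Type*) [Fintype A] [DecidableEq A] (n t : ℕ) : Submodule ℂ (Op A n) :=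
  Submodule.span ℂ {E | ∃ T : Finset (Fin n), T.card ≤ t ∧ ActsOn T E}

/-- An error on the physical qudits, the receiver's `c` qudits being error-free. -/
def onPhysical (c : ℕ) (E : Op A n) : Matrix (Joint A n c) (Joint A n c) ℂ :=
  E ⊗ₖ (1 : Op A c)

/-- The code detects all errors on at most `t` physical qudits: compressed to the code space,
every such error is a scalar. -/
def Code.Detects (Q : Code A n k c) (t : ℕ) : Prop :=
  ∀ E ∈ errorSpace A n t, ∃ r : ℂ,
    (Q.encode)ᴴ * onPhysical c E * Q.encode = r • (1 : Op A k)

/-- The code corrects `t` errors: there is one quantum channel, with Kraus operators `R j`, that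
recovers every logical state after every noise channel on the physical qudits whose Kraus operators
`E i` are combinations of errors on at most `t` qudits. -/
def Code.Corrects (Q : Code A n k c) (t : ℕ) : Prop :=
  ∃ (M : ℕ) (R : Fin M → Matrix (Fin k → A) (Joint A n c) ℂ),
    ∑ j, (R j)ᴴ * R j = 1 ∧
    ∀ (N : ℕ) (E : Fin N → Op A n), (∀ i, E i ∈ errorSpace A n t) → ∑ i, (E i)ᴴ * E i = 1 →
      ∀ ρ : Op A k,
        ∑ j, R j * (∑ i, onPhysical c (E i) * (Q.encode * ρ * (Q.encode)ᴴ)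
          * (onPhysical c (E i))ᴴ) * (R j)ᴴ = ρ

/-- The code has minimum distance at least `d`: it detects all errors on fewer than `d` qudits and
corrects `⌊(d - 1) / 2⌋` errors. So `Q : Code A n k c` with `Q.DistGE d` is an `[[n, k, ≥ d; c]]_q`
code, `q = |A|`. -/
def Code.DistGE (Q : Code A n k c) (d : ℕ) : Prop :=
  (∀ t, t < d → Q.Detects t) ∧ Q.Corrects ((d - 1) / 2)

section Stabilizer

variable {F : Type*} [Field F] [Fintype F] [DecidableEq F]

/-- The shift operator `X(u) : |x⟩ ↦ |x + u⟩`. -/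
def shiftOp {m : ℕ} (u : Fin m → F) : Op F m :=
  Matrix.of fun x y => if x = y + u then 1 else 0

/-- The phase operator `Z(v) : |x⟩ ↦ χ(v · x) |x⟩`. -/
def phaseOp {m : ℕ} (χ : AddChar F ℂ) (v : Fin m → F) : Op F m :=
  Matrix.diagonal fun x => χ (v ⬝ᵥ x)

/-- `Q` is the entanglement-assisted stabilizer code of the Euclidean construction from the linear
codes `C₁` and `C₂`: the operators `X(u)`, `u ∈ C₁^⊥`, and `Z(v)`, `v ∈ C₂^⊥`, on the physical qudits,
each extended by a suitable `X(w)` or `Z(w)` on the receiver's qudits, fix every code state, and the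
numbers of logical and entangled qudits are `k = dim C₁ + dim C₂ - n + c` and
`c = dim C₁^⊥ - dim (C₁^⊥ ∩ C₂)`. -/
structure Code.IsEuclidean (Q : Code F n k c) (C₁ C₂ : Submodule F (Fin n → F)) : Prop where
  shift : ∀ u ∈ RationalAG.dual C₁, ∃ w : Fin c → F,
    (shiftOp u ⊗ₖ shiftOp w) * Q.encode = Q.encode
  phase : ∀ χ : AddChar F ℂ, ∀ v ∈ RationalAG.dual C₂, ∃ w : Fin c → F,
    (phaseOp χ v ⊗ₖ phaseOp χ w) * Q.encode = Q.encode
  logical : k + n = Module.finrank F C₁ + Module.finrank F C₂ + c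
  entangled : c + Module.finrank F ↥(RationalAG.dual C₁ ⊓ C₂) =
    Module.finrank F (RationalAG.dual C₁)

end Stabilizer

end Quenta

end

/-!
A code state of the Euclidean construction from `C₁` and `C₂` is a uniform superposition over
cosets of `I = C₁^⊥ ∩ C₂`. With `C₂ = I ⊕ im L` and `C₁^⊥ = I ⊕ im M`, the encoder sends a logical
label `x` and an entangled label `y` to the coset `L x + M y + I`. The sums `I + im L + im M`
being direct, this is an isometry, and `X(u)`, `u ∈ C₁^⊥`, permutes the labels `y` while `Z(v)`,
`v ∈ C₂^⊥`, multiplies by a phase depending on `y` alone; both are undone on the receiver's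
qudits. This gives the parameters `c = dim C₁^⊥ - dim I` and `k = dim C₂ - dim I`
(`Quenta.exists_isEuclidean_distGE`).

Suppose that nonzero words of `C₁` and `C₂` have weight at least `d`, and let `E` act on a set `T`
of fewer than `d` qudits. Basis states in code states with the same `y` differ by words of `C₂`,
so `E` cannot connect two different ones, and off-diagonal terms vanish. As no nonzero word of
`C₁` is supported on `T`, the restriction of `C₁^⊥` to `T` is everything
(`RationalAG.exists_mem_dual_eqOn`), so the diagonal terms average over all values on `T` and do
not depend on `x`. Hence `E` compresses to a scalar (`Quenta.CosetData.detects`). Correction of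
half as many errors follows by the Knill–Laflamme argument
(`Matrix.exists_recovery_of_scalar_compression`): the operators `E V`, for `V` the encoding
isometry, form an inner product space under `Xᴴ Y = ⟨X, Y⟩ • 1`, and the adjoints of an
orthonormal basis are Kraus operators of a recovery channel.

A function in `L(a P₀ + b P_∞)` is `z ^ (-a)` times a polynomial of degree at most `a + b`
(`RationalAG.mem_agCode_twoPoint_iff`). So nonzero words of the code have weight at least
`q - 1 - (a + b)`, and the code is spanned by the monomials `z ^ j`, `-a ≤ j ≤ b`, with exponents
modulo `q - 1`. By the orthogonality of the monomials on the nonzero elements of the field, the dual is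
spanned by the `z ^ j` with `a < j < q - 1 - b`. The dual of the first code therefore meets the
second one in the span of the `z ^ j` with `a₁ < j ≤ b₂`, and counting exponents gives the
parameters in both cases.
-/

/-! ### Error correction from scalar compressions -/

section KnillLaflamme

open scoped ComplexOrder

variable {ι κ : Type*} [Fintype ι] [DecidableEq ι] [Fintype κ]

/-- A space of operators in which all products `Xᴴ * Y` are scalar has an orthonormal basis for the
inner product given by these scalars. -/
theorem Matrix.exists_orthonormal_of_conjTranspose_mul_scalar [Nonempty ι]
    (S : Submodule ℂ (Matrix κ ι ℂ))
    (hS : ∀ X ∈ S, ∀ Y ∈ S, ∃ r : ℂ, Xᴴ * Y = r • (1 : Matrix ι ι ℂ)) :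
    ∃ (m : ℕ) (W : Fin m → Matrix κ ι ℂ),
      (∀ i j, (W i)ᴴ * W j = if i = j then 1 else 0) ∧
      ∀ X ∈ S, ∃ α : Fin m → ℂ, X = ∑ j, α j • W j := by
  classical
  obtain ⟨x₀⟩ := ‹Nonempty ι›
  -- One fixed column embeds `S` isometrically into a Euclidean space.
  let col : Matrix κ ι ℂ →ₗ[ℂ] EuclideanSpace ℂ κ :=
    { toFun := fun X => WithLp.toLp 2 fun s => X s x₀
      map_add' := fun _ _ => rfl
      map_smul' := fun _ _ => rfl }
  have hcol : ∀ X Y, inner ℂ (col X) (col Y) = (Xᴴ * Y) x₀ x₀ := by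
    intro X Y
    simp only [PiLp.inner_apply, Matrix.mul_apply, Matrix.conjTranspose_apply]
    exact Finset.sum_congr rfl fun s _ => mul_comm _ _
  have hscal : ∀ X ∈ S, ∀ Y ∈ S, Xᴴ * Y = (inner ℂ (col X) (col Y) : ℂ) • 1 := by
    intro X hX Y hY
    obtain ⟨r, hr⟩ := hS X hX Y hY
    rw [hcol, hr]
    simp
  let b := stdOrthonormalBasis ℂ (S.map col)
  have hb : ∀ j, ∃ X ∈ S, col X = (b j : EuclideanSpace ℂ κ) := fun j => (b j).2
  choose W hWS hW using hb
  refine ⟨_, W, fun i j => ?_, fun X hX => ?_⟩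
  · have h := orthonormal_iff_ite.1 b.orthonormal i j
    rw [hscal _ (hWS i) _ (hWS j), hW, hW, ← Submodule.coe_inner, h]
    split_ifs <;> simp
  · let x : S.map col := ⟨col X, Submodule.mem_map_of_mem hX⟩
    refine ⟨fun j => b.repr x j, ?_⟩
    set Y := ∑ j, b.repr x j • W j with hY
    have hYS : Y ∈ S := S.sum_mem fun j _ => S.smul_mem _ (hWS j)
    have hXY : col (X - Y) = 0 := by
      have h := congrArg (Subtype.val : S.map col → EuclideanSpace ℂ κ) (b.sum_repr x)
      simp only [Submodule.coe_sum, Submodule.coe_smul] at h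
      rw [map_sub, hY, map_sum]
      simp only [map_smul, hW]
      rw [h, sub_self]
    have h0 := hscal _ (S.sub_mem hX hYS) _ (S.sub_mem hX hYS)
    rw [hXY, inner_zero_left, zero_smul, Matrix.conjTranspose_mul_self_eq_zero] at h0
    exact sub_eq_zero.1 h0

/-- The sufficiency half of the Knill–Laflamme theorem: if the products `Eᴴ * E'` of errors from a
space `S` compress to scalars on the code with encoding isometry `V`, then one channel recovers
every logical state after every noise channel with Kraus operators in `S`. -/
theorem Matrix.exists_recovery_of_scalar_compression [Nonempty ι] [DecidableEq κ]
    (V : Matrix κ ι ℂ) (hV : Vᴴ * V = 1) (S : Submodule ℂ (Matrix κ κ ℂ))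
    (hS : ∀ E ∈ S, ∀ E' ∈ S, ∃ r : ℂ, Vᴴ * (Eᴴ * E') * V = r • (1 : Matrix ι ι ℂ)) :
    ∃ (M : ℕ) (R : Fin M → Matrix ι κ ℂ), ∑ j, (R j)ᴴ * R j = 1 ∧
      ∀ (N : ℕ) (E : Fin N → Matrix κ κ ℂ), (∀ i, E i ∈ S) → ∑ i, (E i)ᴴ * E i = 1 →
        ∀ ρ : Matrix ι ι ℂ,
          ∑ j, R j * (∑ i, E i * (V * ρ * Vᴴ) * (E i)ᴴ) * (R j)ᴴ = ρ := by
  classical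
  let mulV : Matrix κ κ ℂ →ₗ[ℂ] Matrix κ ι ℂ :=
    { toFun := fun E => E * V
      map_add' := fun _ _ => Matrix.add_mul _ _ _
      map_smul' := fun _ _ => Matrix.smul_mul _ _ _ }
  obtain ⟨m, W, hW, hspan⟩ :=
    Matrix.exists_orthonormal_of_conjTranspose_mul_scalar (S.map mulV) (by
      rintro _ ⟨E, hE, rfl⟩ _ ⟨E', hE', rfl⟩
      obtain ⟨r, hr⟩ := hS E hE E' hE'
      exact ⟨r, by simpa [mulV, Matrix.mul_assoc] using hr⟩)
  -- `p` projects onto the span of the ranges of the `W j`.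
  set p : Matrix κ κ ℂ := ∑ j, W j * (W j)ᴴ with hp
  have hpW : ∀ j, p * W j = W j := by
    intro j
    rw [hp, Matrix.sum_mul, Finset.sum_eq_single j]
    · rw [Matrix.mul_assoc, hW, if_pos rfl, Matrix.mul_one]
    · intro i _ hij
      rw [Matrix.mul_assoc, hW, if_neg hij, Matrix.mul_zero]
    · simp
  have hpH : pᴴ = p := by
    rw [hp, Matrix.conjTranspose_sum]
    simp
  have hpp : p * p = p := by
    conv_lhs => rw [hp, ← hp, Matrix.mul_sum]
    simp only [← Matrix.mul_assoc, hpW]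
    rfl
  obtain ⟨x₀⟩ := ‹Nonempty ι›
  -- The Kraus operators `|x₀⟩⟨s| (1 - p)` complete the `(W j)ᴴ` to a channel.
  let T : Fin m ⊕ κ → Matrix ι κ ℂ :=
    Sum.elim (fun j => (W j)ᴴ) (fun s => Matrix.single x₀ s (1 : ℂ) * (1 - p))
  have hTsum : ∑ a, (T a)ᴴ * T a = 1 := by
    have h1 : ∑ s : κ, (Matrix.single s s (1 : ℂ)) = 1 := by
      rw [← Matrix.diagonal_one, ← Matrix.sum_single_eq_diagonal]
    have h2 : ∀ s, (Matrix.single x₀ s (1 : ℂ) * (1 - p))ᴴ * (Matrix.single x₀ s (1 : ℂ) * (1 - p))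
        = (1 - p) * Matrix.single s s (1 : ℂ) * (1 - p) := by
      intro s
      rw [Matrix.conjTranspose_mul, Matrix.conjTranspose_sub, hpH, Matrix.conjTranspose_one,
        Matrix.conjTranspose_single, Matrix.mul_assoc, ← Matrix.mul_assoc (Matrix.single s x₀ _),
        Matrix.single_mul_single_same]
      simp [Matrix.mul_assoc]
    rw [Fintype.sum_sum_type]
    simp only [T, Sum.elim_inl, Sum.elim_inr, Matrix.conjTranspose_conjTranspose, h2]
    rw [← hp, ← Matrix.sum_mul, ← Matrix.mul_sum, h1, Matrix.mul_one, Matrix.sub_mul,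
      Matrix.mul_sub p, hpp]
    simp
  let e := Fintype.equivFin (Fin m ⊕ κ)
  refine ⟨_, fun j => T (e.symm j), ?_, fun N E hE hsum ρ => ?_⟩
  · rw [← hTsum]
    exact e.symm.sum_comp fun a => (T a)ᴴ * T a
  rw [e.symm.sum_comp fun a => T a * (∑ i, E i * (V * ρ * Vᴴ) * (E i)ᴴ) * (T a)ᴴ]
  have hα : ∀ i, ∃ α : Fin m → ℂ, E i * V = ∑ j, α j • W j :=
    fun i => hspan _ (Submodule.mem_map_of_mem (f := mulV) (hE i))
  choose α hα using hα
  have hWE : ∀ j i, (W j)ᴴ * (E i * V) = α i j • (1 : Matrix ι ι ℂ) := by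
    intro j i
    rw [hα, Matrix.mul_sum, Finset.sum_eq_single j]
    · rw [Matrix.mul_smul, hW, if_pos rfl]
    · intro l _ hl
      rw [Matrix.mul_smul, hW, if_neg hl.symm, smul_zero]
    · simp
  have hPE : ∀ i, (1 - p) * (E i * V) = 0 := by
    intro i
    rw [Matrix.sub_mul, Matrix.one_mul, hα, Matrix.mul_sum]
    simp [Matrix.mul_smul, hpW]
  have hnorm : ∑ i, ∑ j, star (α i j) * α i j = 1 := by
    have h : ∑ i, ((E i * V)ᴴ * (E i * V)) = 1 := by
      have h' := congrArg (fun X => Vᴴ * X * V) hsum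
      simp only [Matrix.mul_sum, Matrix.sum_mul, Matrix.mul_one, hV] at h'
      simpa [Matrix.mul_assoc] using h'
    have h' : ∀ i, (E i * V)ᴴ * (E i * V)
        = (∑ j, star (α i j) * α i j) • (1 : Matrix ι ι ℂ) := by
      intro i
      have h₁ : (E i * V)ᴴ * (E i * V) = (∑ j, α i j • W j)ᴴ * (E i * V) := by rw [← hα]
      rw [h₁, Matrix.conjTranspose_sum, Matrix.sum_mul]
      simp [hWE, Finset.sum_smul, smul_smul, mul_comm]
    simp only [h'] at h
    rw [← Finset.sum_smul] at h
    simpa using congrFun (congrFun h x₀) x₀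
  have key : ∀ (B : Matrix ι κ ℂ) i, B * (E i * (V * ρ * Vᴴ) * (E i)ᴴ) * Bᴴ
      = (B * (E i * V)) * ρ * (B * (E i * V))ᴴ := by
    intro B i
    simp [Matrix.mul_assoc]
  simp only [Matrix.mul_sum, Matrix.sum_mul, key]
  rw [Fintype.sum_sum_type]
  simp only [T, Sum.elim_inl, Sum.elim_inr, hWE, Matrix.mul_assoc (Matrix.single _ _ _), hPE]
  simp only [Matrix.mul_zero, Matrix.zero_mul, Finset.sum_const_zero, add_zero]
  rw [Finset.sum_comm]
  simp only [Matrix.conjTranspose_smul, Matrix.conjTranspose_one, Matrix.smul_mul, Matrix.mul_smul,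
    Matrix.one_mul, Matrix.mul_one, smul_smul, ← Finset.sum_smul]
  rw [hnorm, one_smul]

end KnillLaflamme

/-! ### Operators on few qudits, detection and correction -/

namespace Quenta

section Errors

variable {A : Type*} [DecidableEq A] {n k c : ℕ}

/-- An operator acts on the qudits in `T` iff it is `e ⊗ 1` for the splitting of the qudits into
those in `T` and the others. -/
theorem actsOn_iff_kronecker (T : Finset (Fin n)) (E : Op A n) :
    ActsOn T E ↔ ∃ e : Matrix (T → A) (T → A) ℂ,
      E = (e ⊗ₖ (1 : Matrix ({i // i ∉ T} → A) ({i // i ∉ T} → A) ℂ)).submatrix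
        (Equiv.piEquivPiSubtypeProd (· ∈ T) fun _ => A)
        (Equiv.piEquivPiSubtypeProd (· ∈ T) fun _ => A) := by
  refine exists_congr fun e => ?_
  rw [← Matrix.ext_iff]
  refine forall_congr' fun x => forall_congr' fun y => ?_
  rw [Matrix.submatrix_apply, Matrix.kroneckerMap_apply, Matrix.one_apply]
  simp [Equiv.piEquivPiSubtypeProd, funext_iff]

theorem ActsOn.mono {T T' : Finset (Fin n)} (h : T ⊆ T') {E : Op A n} (hE : ActsOn T E) :
    ActsOn T' E := by
  obtain ⟨e, he⟩ := hE
  refine ⟨fun a b => if ∀ i : T', (i : Fin n) ∉ T → a i = b i then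
    e (fun i => a ⟨i, h i.2⟩) (fun i => b ⟨i, h i.2⟩) else 0, fun x y => ?_⟩
  rw [he]
  dsimp only
  by_cases h1 : ∀ i, i ∉ T → x i = y i
  · rw [if_pos h1, if_pos fun i hi => h1 i fun hT => hi (h hT), if_pos fun (i : T') hi => h1 i hi]
  · rw [if_neg h1]
    by_cases h2 : ∀ i, i ∉ T' → x i = y i
    · rw [if_pos h2, if_neg]
      refine fun h3 => h1 fun i hi => ?_
      by_cases hT : i ∈ T'
      · exact h3 ⟨i, hT⟩ hi
      · exact h2 i hT
    · rw [if_neg h2]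

theorem onPhysical_conjTranspose (E : Op A n) : (onPhysical c E)ᴴ = onPhysical c Eᴴ := by
  rw [onPhysical, Matrix.conjTranspose_kronecker, Matrix.conjTranspose_one, onPhysical]

variable [Fintype A]

theorem ActsOn.conjTranspose_mul {T T' : Finset (Fin n)} {E E' : Op A n} (hE : ActsOn T E)
    (hE' : ActsOn T' E') : ActsOn (T ∪ T') (Eᴴ * E') := by
  obtain ⟨e, rfl⟩ := (actsOn_iff_kronecker _ _).1 (hE.mono (Finset.subset_union_left (s₂ := T')))
  obtain ⟨e', rfl⟩ := (actsOn_iff_kronecker _ _).1 (hE'.mono (Finset.subset_union_right (s₁ := T)))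
  refine (actsOn_iff_kronecker _ _).2 ⟨eᴴ * e', ?_⟩
  rw [Matrix.conjTranspose_submatrix, Matrix.submatrix_mul_equiv, Matrix.conjTranspose_kronecker,
    ← Matrix.mul_kronecker_mul, Matrix.conjTranspose_one, Matrix.mul_one]

theorem conjTranspose_mul_mem_errorSpace {t t' : ℕ} {E E' : Op A n} (hE : E ∈ errorSpace A n t)
    (hE' : E' ∈ errorSpace A n t') : Eᴴ * E' ∈ errorSpace A n (t + t') := by
  induction hE using Submodule.span_induction with
  | mem E hE =>
    obtain ⟨T, hT, hE⟩ := hE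
    induction hE' using Submodule.span_induction with
    | mem E' hE' =>
      obtain ⟨T', hT', hE'⟩ := hE'
      exact Submodule.subset_span ⟨T ∪ T', (Finset.card_union_le _ _).trans (add_le_add hT hT'),
        hE.conjTranspose_mul hE'⟩
    | zero => rw [Matrix.mul_zero]; exact zero_mem _
    | add X Y _ _ hX hY => rw [Matrix.mul_add]; exact add_mem hX hY
    | smul r X _ hX => rw [Matrix.mul_smul]; exact Submodule.smul_mem _ _ hX
  | zero => rw [Matrix.conjTranspose_zero, Matrix.zero_mul]; exact zero_mem _
  | add X Y _ _ hX hY => rw [Matrix.conjTranspose_add, Matrix.add_mul]; exact add_mem hX hY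
  | smul r X _ hX =>
    rw [Matrix.conjTranspose_smul, Matrix.smul_mul]; exact Submodule.smul_mem _ _ hX

/-- `onPhysical` as a linear map. -/
def onPhysicalₗ (A : Type*) [Fintype A] [DecidableEq A] (n c : ℕ) :
    Op A n →ₗ[ℂ] Matrix (Joint A n c) (Joint A n c) ℂ where
  toFun := onPhysical c
  map_add' X Y := Matrix.add_kronecker X Y _
  map_smul' r X := Matrix.smul_kronecker r X _

theorem onPhysical_mul (E E' : Op A n) :
    onPhysical c (E * E') = onPhysical c E * onPhysical c E' := by
  rw [onPhysical, onPhysical, onPhysical, ← Matrix.mul_kronecker_mul, Matrix.mul_one]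

theorem Code.encode_apply (Q : Code A n k c) (s : Joint A n c) (x : Fin k → A) :
    Q.encode s x = Q.enc s.1 (x, s.2) * (((Real.sqrt (Fintype.card A : ℝ)) ^ c)⁻¹ : ℝ) := by
  simp [Code.encode, maxEntangled]

theorem Code.encode_isometry [Nonempty A] (Q : Code A n k c) : (Q.encode)ᴴ * Q.encode = 1 := by
  have hq : (0 : ℝ) < Fintype.card A := by exact_mod_cast Fintype.card_pos
  ext x x'
  have h : ∀ y, ∑ s, star (Q.enc s (x, y)) * Q.enc s (x', y) = if x = x' then 1 else 0 := by
    intro y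
    have h := congrFun (congrFun Q.isometry (x, y)) (x', y)
    simpa [Matrix.mul_apply, Matrix.one_apply] using h
  set α : ℝ := ((Real.sqrt (Fintype.card A : ℝ)) ^ c)⁻¹ with hα
  have hα2 : (Fintype.card (Fin c → A) : ℂ) * ((α : ℂ) * α) = 1 := by
    have : (Fintype.card (Fin c → A) : ℝ) * (α * α) = 1 := by
      rw [Fintype.card_fun, Fintype.card_fin, hα, ← mul_inv, ← mul_pow,
        Real.mul_self_sqrt hq.le]
      push_cast
      exact mul_inv_cancel₀ (pow_ne_zero _ hq.ne')
    exact_mod_cast this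
  have h2 : ∀ s y, star (Q.enc s (x, y) * (α : ℂ)) * (Q.enc s (x', y) * (α : ℂ))
      = (star (Q.enc s (x, y)) * Q.enc s (x', y)) * ((α : ℂ) * α) := by
    intro s y
    rw [star_mul']
    simp only [Complex.star_def, Complex.conj_ofReal]
    ring
  rw [Matrix.mul_apply, Fintype.sum_prod_type_right, Matrix.one_apply]
  simp only [Matrix.conjTranspose_apply, Code.encode_apply, ← hα, h2, ← Finset.sum_mul, h]
  rw [Finset.sum_const, Finset.card_univ, nsmul_eq_mul]
  split_ifs
  · rw [mul_one, hα2]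
  · simp

/-- Detection of all errors on `2 * t` qudits gives correction of `t` errors. -/
theorem Code.Detects.corrects [Nonempty A] (Q : Code A n k c) {t : ℕ} (h : Q.Detects (t + t)) :
    Q.Corrects t := by
  obtain ⟨M, R, hR, hrec⟩ := Matrix.exists_recovery_of_scalar_compression Q.encode
    Q.encode_isometry ((errorSpace A n t).map (onPhysicalₗ A n c)) (by
      rintro _ ⟨E, hE, rfl⟩ _ ⟨E', hE', rfl⟩
      obtain ⟨r, hr⟩ := h _ (conjTranspose_mul_mem_errorSpace hE hE')
      refine ⟨r, ?_⟩
      rw [← hr, onPhysical_mul, ← onPhysical_conjTranspose]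
      rfl)
  refine ⟨M, R, hR, fun N E hE hsum ρ => ?_⟩
  refine hrec N (fun i => onPhysical c (E i))
    (fun i => Submodule.mem_map_of_mem (f := onPhysicalₗ A n c) (hE i)) ?_ ρ
  have h1 : onPhysicalₗ A n c (∑ i, (E i)ᴴ * E i) = 1 := by
    rw [hsum]
    exact Matrix.one_kronecker_one
  rw [← h1, map_sum]
  refine Finset.sum_congr rfl fun i _ => ?_
  rw [onPhysical_conjTranspose, ← onPhysical_mul]
  rfl

/-- Detection has only to be tested on errors supported on few qudits. -/
theorem Code.detects_of_actsOn (Q : Code A n k c) {t : ℕ}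
    (h : ∀ (T : Finset (Fin n)) (E : Op A n), T.card ≤ t → ActsOn T E →
      ∃ r : ℂ, (Q.encode)ᴴ * onPhysical c E * Q.encode = r • (1 : Op A k)) :
    Q.Detects t := by
  intro E hE
  induction hE using Submodule.span_induction with
  | mem E hE =>
    obtain ⟨T, hT, hE⟩ := hE
    exact h T E hT hE
  | zero => exact ⟨0, by simp [onPhysical]⟩
  | add X Y _ _ hX hY =>
    obtain ⟨r, hr⟩ := hX
    obtain ⟨r', hr'⟩ := hY
    refine ⟨r + r', ?_⟩
    rw [add_smul, ← hr, ← hr', ← Matrix.add_mul, ← Matrix.mul_add]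
    congr 2
    exact (onPhysicalₗ A n c).map_add X Y
  | smul a X _ hX =>
    obtain ⟨r, hr⟩ := hX
    refine ⟨a * r, ?_⟩
    rw [mul_smul, ← hr, ← Matrix.smul_mul, ← Matrix.mul_smul]
    congr 2
    exact (onPhysicalₗ A n c).map_smul a X

end Errors

end Quenta

/-! ### Duality of linear codes -/

namespace RationalAG

variable {F : Type*} [Field F] {n : ℕ}

theorem dual_eq_comap (C : Submodule F (Fin n → F)) :
    dual C = C.dualAnnihilator.comap (dotProductEquiv F (Fin n)).toLinearMap := by
  ext x
  simp [dual, Submodule.mem_dualAnnihilator]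

theorem finrank_add_finrank_dual (C : Submodule F (Fin n → F)) :
    Module.finrank F C + Module.finrank F (dual C) = n := by
  have h := Subspace.finrank_add_finrank_dualAnnihilator_eq C
  rw [Module.finrank_fin_fun] at h
  rw [dual_eq_comap, Submodule.comap_equiv_eq_map_symm, LinearEquiv.finrank_map_eq]
  exact h

theorem mem_of_forall_dual {C : Submodule F (Fin n → F)} {v : Fin n → F}
    (h : ∀ u ∈ dual C, u ⬝ᵥ v = 0) : v ∈ C := by
  rw [← Subspace.forall_mem_dualAnnihilator_apply_eq_zero_iff]
  intro φ hφ
  have h1 : (dotProductEquiv F (Fin n)).symm φ ∈ dual C := by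
    rw [dual_eq_comap]
    simpa using hφ
  have h2 := h _ h1
  rwa [← dotProductEquiv_apply_apply, LinearEquiv.apply_symm_apply] at h2

/-- If no nonzero word of `C` is supported on `T`, the dual of `C` takes all values on `T`. -/
theorem exists_mem_dual_eqOn {C : Submodule F (Fin n → F)} {T : Finset (Fin n)}
    (hC : ∀ x ∈ C, (∀ i, i ∉ T → x i = 0) → x = 0) (y : Fin n → F) :
    ∃ u ∈ dual C, ∀ i ∈ T, u i = y i := by
  let π : (Fin n → F) →ₗ[F] (T → F) := LinearMap.funLeft F F Subtype.val
  have hπ : Function.Surjective π :=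
    LinearMap.funLeft_surjective_of_injective F F _ Subtype.val_injective
  suffices h : (dual C).map π = ⊤ by
    have hy : π y ∈ (dual C).map π := h ▸ Submodule.mem_top
    obtain ⟨u, hu, huy⟩ := hy
    exact ⟨u, hu, fun i hi => congrFun huy ⟨i, hi⟩⟩
  by_contra h
  -- A functional on `F ^ T` killing all restrictions extends by zero to a word of the double dual.
  obtain ⟨g, hg, hle⟩ := Submodule.exists_le_ker_of_lt_top _ (lt_top_iff_ne_top.2 h)
  set v := (dotProductEquiv F (Fin n)).symm (g ∘ₗ π) with hv
  have hvu : ∀ u, v ⬝ᵥ u = g (π u) := by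
    intro u
    rw [← dotProductEquiv_apply_apply, hv, LinearEquiv.apply_symm_apply]
    rfl
  have hvC : v ∈ C := by
    refine mem_of_forall_dual fun u hu => ?_
    rw [dotProduct_comm, hvu]
    exact hle (Submodule.mem_map_of_mem hu)
  have hv0 : v = 0 := by
    refine hC v hvC fun i hi => ?_
    have h1 := hvu (Pi.single i 1)
    rw [dotProduct_single, mul_one] at h1
    have h2 : π (Pi.single i 1) = 0 := by
      ext j
      exact Pi.single_eq_of_ne (fun hj : (j : Fin n) = i => hi (hj ▸ j.2)) _
    rw [h1, h2, map_zero]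
  refine hg (LinearMap.ext fun z => ?_)
  obtain ⟨u, rfl⟩ := hπ z
  rw [← hvu, hv0, zero_dotProduct, LinearMap.zero_apply]

/-- A complement of `I` in `U`, parametrized by `F ^ c`. -/
theorem exists_parametrized_complement {V : Type*} [AddCommGroup V] [Module F V]
    [FiniteDimensional F V] {I U : Submodule F V} (hIU : I ≤ U) {c : ℕ}
    (hc : c + Module.finrank F I = Module.finrank F U) :
    ∃ M : (Fin c → F) →ₗ[F] V, (∀ y, M y ∈ U) ∧ (∀ y, M y ∈ I → y = 0) ∧
      ∀ u ∈ U, ∃ y, u - M y ∈ I := by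
  obtain ⟨W, hW⟩ := Submodule.exists_isCompl (I.submoduleOf U)
  have h1 := Submodule.finrank_add_eq_of_isCompl hW
  have h2 : Module.finrank F (I.submoduleOf U) = Module.finrank F I :=
    (Submodule.submoduleOfEquivOfLe hIU).finrank_eq
  let e : (Fin c → F) ≃ₗ[F] W := LinearEquiv.ofFinrankEq _ _ (by
    rw [Module.finrank_fin_fun]; omega)
  refine ⟨U.subtype ∘ₗ W.subtype ∘ₗ e.toLinearMap, fun y => (e y : U).2, fun y hy => ?_,
    fun u hu => ?_⟩
  · have h3 : (e y : U) ∈ I.submoduleOf U ⊓ W := ⟨hy, (e y).2⟩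
    rw [hW.inf_eq_bot, Submodule.mem_bot] at h3
    exact e.map_eq_zero_iff.1 (Subtype.ext h3)
  · have h3 : (⟨u, hu⟩ : U) ∈ I.submoduleOf U ⊔ W := hW.sup_eq_top ▸ Submodule.mem_top
    obtain ⟨a, ha, w, hw, haw⟩ := Submodule.mem_sup.1 h3
    refine ⟨e.symm ⟨w, hw⟩, ?_⟩
    have h4 : u = a + w := (congrArg Subtype.val haw).symm
    change (a : V) ∈ I at ha
    simpa [h4] using ha

end RationalAG

/-! ### The code of the Euclidean construction -/

namespace Quenta

section Construction

variable {F : Type*} [Field F] [Fintype F] {n k c : ℕ}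

/-- Linear data for a code whose states are superpositions of cosets of `I`: the logical and the
entangled basis labels choose the coset through the maps `L` and `M`, which together are injective
modulo `I`. -/
structure CosetData (F : Type*) [Field F] (n k c : ℕ) where
  /-- The subspace whose cosets are superposed. -/
  I : Submodule F (Fin n → F)
  /-- The coset shift of a logical label. -/
  L : (Fin k → F) →ₗ[F] (Fin n → F)
  /-- The coset shift of an entangled label. -/
  M : (Fin c → F) →ₗ[F] (Fin n → F)
  indep : ∀ x y, L x + M y ∈ I → x = 0 ∧ y = 0

namespace CosetData

open Classical in
/-- The sum over a coset of `I` as a sum over `I`. -/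
theorem sum_coset (I : Submodule F (Fin n → F)) (a : Fin n → F) (g : (Fin n → F) → ℂ) :
    ∑ s, (if s - a ∈ I then g s else 0) = ∑ u : I, g (a + u) := by
  rw [← Equiv.sum_comp (Equiv.addLeft a)]
  simp only [Equiv.coe_addLeft, add_sub_cancel_left]
  rw [← Finset.sum_filter]
  exact Finset.sum_subtype _ (by simp) _

variable (D : CosetData F n k c)

/-- The normalization `|I|^{-1/2}` of a uniform superposition over a coset of `I`. -/
noncomputable def norm : ℝ := (Real.sqrt (Nat.card D.I))⁻¹

theorem card_mul_norm_sq : (Nat.card D.I : ℂ) * ((D.norm : ℂ) * D.norm) = 1 := by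
  have h : (0 : ℝ) < Nat.card D.I := by exact_mod_cast Nat.card_pos
  have : (Nat.card D.I : ℝ) * (D.norm * D.norm) = 1 := by
    rw [norm, ← mul_inv, Real.mul_self_sqrt h.le]
    exact mul_inv_cancel₀ h.ne'
  exact_mod_cast this

variable [DecidableEq F]

open Classical in
/-- The encoder sending `|x⟩|y⟩` to the uniform superposition over the coset `L x + M y + I`. -/
noncomputable def code : Code F n k c where
  enc := Matrix.of fun s p => if s - (D.L p.1 + D.M p.2) ∈ D.I then (D.norm : ℂ) else 0
  isometry := by
    ext p p'
    simp only [Matrix.mul_apply, Matrix.conjTranspose_apply, Matrix.of_apply]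
    have h : ∀ s, star (if s - (D.L p.1 + D.M p.2) ∈ D.I then (D.norm : ℂ) else 0)
          * (if s - (D.L p'.1 + D.M p'.2) ∈ D.I then (D.norm : ℂ) else 0)
        = if s - (D.L p.1 + D.M p.2) ∈ D.I then
            (if p = p' then (D.norm : ℂ) * D.norm else 0) else 0 := by
      intro s
      by_cases h1 : s - (D.L p.1 + D.M p.2) ∈ D.I
      · rw [if_pos h1, if_pos h1]
        by_cases hp : p = p'
        · rw [if_pos hp, ← hp, if_pos h1, Complex.star_def, Complex.conj_ofReal]
        · rw [if_neg hp, if_neg, mul_zero]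
          intro h2
          have h3 : D.L (p'.1 - p.1) + D.M (p'.2 - p.2) ∈ D.I := by
            have h4 := D.I.sub_mem h1 h2
            rw [map_sub, map_sub]
            convert h4 using 1
            abel
          obtain ⟨h5, h6⟩ := D.indep _ _ h3
          exact hp (Prod.ext (sub_eq_zero.1 h5).symm (sub_eq_zero.1 h6).symm)
      · rw [if_neg h1, if_neg h1, star_zero, zero_mul]
    simp only [h]
    rw [sum_coset, Finset.sum_const, Finset.card_univ, nsmul_eq_mul, ← Nat.card_eq_fintype_card,
      Matrix.one_apply]
    split_ifs
    · exact D.card_mul_norm_sq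
    · exact mul_zero _

/-- The amplitude of the basis states in a code state. -/
noncomputable def amp : ℂ := D.norm * (((Real.sqrt (Fintype.card F : ℝ)) ^ c)⁻¹ : ℝ)

open Classical in
theorem encode_apply (s : Joint F n c) (x : Fin k → F) :
    D.code.encode s x = if s.1 - (D.L x + D.M s.2) ∈ D.I then D.amp else 0 := by
  rw [Code.encode_apply]
  simp only [code, Matrix.of_apply, amp, ite_mul, zero_mul]

open Classical in
/-- The matrix of an error compressed to the code space: both copies of the entangled label agree,
since the error leaves the receiver's qudits alone. -/
theorem compression_apply (E : Op F n) (x x' : Fin k → F) :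
    ((D.code.encode)ᴴ * onPhysical c E * D.code.encode) x x' =
      star D.amp * D.amp * ∑ y, ∑ u : D.I, ∑ u' : D.I,
        E (D.L x + D.M y + u) (D.L x' + D.M y + u') := by
  classical
  have h1 : ∀ s y, (onPhysical c E * D.code.encode) (s, y) x' =
      D.amp * ∑ u' : D.I, E s (D.L x' + D.M y + u') := by
    intro s y
    rw [Matrix.mul_apply, Fintype.sum_prod_type_right, Finset.sum_eq_single y]
    · simp only [onPhysical, Matrix.kroneckerMap_apply, Matrix.one_apply_eq, mul_one,
        encode_apply, mul_ite, mul_zero]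
      rw [sum_coset D.I _ fun s' => E s s' * D.amp, ← Finset.sum_mul, mul_comm]
    · intro y' _ hy
      simp [onPhysical, Matrix.one_apply_ne hy.symm]
    · simp
  rw [Matrix.mul_assoc, Matrix.mul_apply, Fintype.sum_prod_type_right, Finset.mul_sum]
  refine Finset.sum_congr rfl fun y _ => ?_
  have h2 : ∀ s, (D.code.encode)ᴴ x (s, y) * (onPhysical c E * D.code.encode) (s, y) x' =
      if s - (D.L x + D.M y) ∈ D.I then
        star D.amp * D.amp * ∑ u' : D.I, E s (D.L x' + D.M y + u') else 0 := by
    intro s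
    rw [h1, Matrix.conjTranspose_apply, encode_apply]
    split_ifs
    · ring
    · rw [star_zero, zero_mul]
  simp only [h2]
  rw [sum_coset D.I _ fun s => star D.amp * D.amp * ∑ u' : D.I, E s (D.L x' + D.M y + u'),
    Finset.mul_sum]

/-- If distinct elements of `im L + I` never agree off a set of fewer than `d` positions, and
`im M + I` takes all values on such a set, then the code detects errors on fewer than `d` qudits: an
error cannot connect different basis states, and its diagonal averages over all values on `T`
whatever the logical label is. -/
theorem detects {d t : ℕ} (ht : t < d)
    (hL : ∀ T : Finset (Fin n), T.card < d → ∀ x, ∀ u ∈ D.I,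
      (∀ i, i ∉ T → (D.L x + u) i = 0) → D.L x + u = 0)
    (hM : ∀ T : Finset (Fin n), T.card < d → ∀ z : Fin n → F, ∃ y, ∃ u ∈ D.I,
      ∀ i ∈ T, (D.M y + u) i = z i) :
    D.code.Detects t := by
  classical
  refine Code.detects_of_actsOn _ fun T E hT ⟨e, he⟩ => ?_
  have hTd : T.card < d := hT.trans_lt ht
  -- Different basis states in code states with the same entangled label differ outside `T`.
  have hzero : ∀ x x' y, ∀ u u' : D.I,
      D.L x + D.M y + (u : Fin n → F) ≠ D.L x' + D.M y + (u' : Fin n → F) →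
      E (D.L x + D.M y + u) (D.L x' + D.M y + u') = 0 := by
    intro x x' y u u' hne
    rw [he, if_neg]
    intro h
    apply hne
    have h1 := hL T hTd (x - x') (u - u') (D.I.sub_mem u.2 u'.2) (fun i hi => by
      have h2 := h i hi
      simp only [Pi.add_apply] at h2
      simp only [map_sub, Pi.add_apply, Pi.sub_apply]
      linear_combination h2)
    rw [map_sub] at h1
    rw [← sub_eq_zero, ← h1]
    abel
  let f : (T → F) → ℂ := fun z => e z z
  have hdiag : ∀ z, E z z = f fun i => z i := fun z => by rw [he, if_pos fun _ _ => rfl]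
  refine ⟨star D.amp * D.amp * ∑ y, ∑ u : D.I, f fun i => (D.M y + u : Fin n → F) i, ?_⟩
  ext x x'
  rw [compression_apply, Matrix.smul_apply, Matrix.one_apply, smul_eq_mul]
  split_ifs with hx
  · subst hx
    rw [mul_one]
    congr 1
    -- Translating `(y, u)` by `(y₀, u₀)` replaces the shift by `L x`, as far as `T` can see.
    obtain ⟨y₀, u₀, hu₀, h₀⟩ := hM T hTd (D.L x)
    rw [← Equiv.sum_comp (Equiv.addRight y₀) fun y =>
      ∑ u : D.I, f fun i => (D.M y + u : Fin n → F) i]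
    refine Finset.sum_congr rfl fun y _ => ?_
    rw [← Equiv.sum_comp (Equiv.addRight (⟨u₀, hu₀⟩ : D.I)) fun u =>
      f fun i => (D.M (Equiv.addRight y₀ y) + u : Fin n → F) i]
    refine Finset.sum_congr rfl fun u _ => ?_
    rw [Finset.sum_eq_single u]
    · rw [hdiag]
      congr 1
      ext i
      have h1 := h₀ i i.2
      simp only [Pi.add_apply] at h1
      simp only [Equiv.coe_addRight, map_add, Pi.add_apply, Submodule.coe_add]
      linear_combination -h1
    · intro u' _ hu
      exact hzero _ _ _ _ _ fun h => hu (Subtype.ext (add_left_cancel h).symm)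
    · simp
  · rw [mul_zero]
    refine mul_eq_zero_of_right _ (Finset.sum_eq_zero fun y _ => Finset.sum_eq_zero fun u _ =>
      Finset.sum_eq_zero fun u' _ => hzero _ _ _ _ _ fun h => hx ?_)
    have h1 : D.L (x - x') + D.M 0 ∈ D.I := by
      have h2 : D.L (x - x') + D.M 0 = (u' - u : Fin n → F) := by
        rw [map_sub, map_zero, add_zero, sub_eq_sub_iff_add_eq_add]
        have h3 : D.M y + (D.L x + u) = D.M y + (D.L x' + u') := by
          convert h using 1 <;> abel
        rw [add_left_cancel h3, add_comm]
      rw [h2]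
      exact D.I.sub_mem u'.2 u.2
    exact sub_eq_zero.1 (D.indep _ _ h1).1

theorem shift_mul_encode {u : Fin n → F} {w : Fin c → F} (h : u - D.M w ∈ D.I) :
    (shiftOp u ⊗ₖ shiftOp w) * D.code.encode = D.code.encode := by
  classical
  ext ⟨s, y⟩ x
  rw [Matrix.mul_apply, Finset.sum_eq_single (s - u, y - w)]
  · rw [Matrix.kroneckerMap_apply, shiftOp, shiftOp, Matrix.of_apply, Matrix.of_apply,
      if_pos (sub_add_cancel s u).symm, if_pos (sub_add_cancel y w).symm, one_mul, one_mul,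
      encode_apply, encode_apply]
    refine if_congr ?_ rfl rfl
    have h1 : s - (D.L x + D.M y) = (s - u - (D.L x + D.M (y - w))) + (u - D.M w) := by
      rw [map_sub]
      abel
    rw [h1]
    exact (D.I.add_mem_iff_left h).symm
  · rintro ⟨s', y'⟩ _ hne
    rw [Matrix.kroneckerMap_apply, shiftOp, shiftOp, Matrix.of_apply, Matrix.of_apply]
    have h1 : ¬(s = s' + u ∧ y = y' + w) := by
      rintro ⟨rfl, rfl⟩
      exact hne (by rw [add_sub_cancel_right, add_sub_cancel_right])
    rcases not_and_or.1 h1 with h2 | h2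
    · rw [if_neg h2, zero_mul, zero_mul]
    · rw [if_neg h2, mul_zero, zero_mul]
  · simp

theorem phase_mul_encode (χ : AddChar F ℂ) {v : Fin n → F} {w : Fin c → F}
    (hI : ∀ u ∈ D.I, v ⬝ᵥ u = 0) (hL : ∀ x, v ⬝ᵥ D.L x = 0)
    (hM : ∀ y, v ⬝ᵥ D.M y + w ⬝ᵥ y = 0) :
    (phaseOp χ v ⊗ₖ phaseOp χ w) * D.code.encode = D.code.encode := by
  classical
  ext ⟨s, y⟩ x
  rw [phaseOp, phaseOp, Matrix.diagonal_kronecker_diagonal, Matrix.diagonal_mul, encode_apply]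
  split_ifs with h
  · have h1 : v ⬝ᵥ s + w ⬝ᵥ y = 0 := by
      have h2 := hI _ h
      rw [dotProduct_sub, dotProduct_add, hL, zero_add, sub_eq_zero] at h2
      rw [← hM y, ← h2]
    rw [← AddChar.map_add_eq_mul, h1, AddChar.map_zero_eq_one, one_mul]
  · rw [mul_zero]

end CosetData

/-- The Euclidean construction. If no nonzero word of `C₁` or `C₂` has weight less than `d`, the
entanglement-assisted code of `C₁` and `C₂` has minimum distance at least `d`. With
`I = C₁^⊥ ∩ C₂`, the logical label ranges over a complement of `I` in `C₂` and the entangled label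
over a complement of `I` in `C₁^⊥`. -/
theorem exists_isEuclidean_distGE {C₁ C₂ : Submodule F (Fin n → F)} [DecidableEq F] {d : ℕ}
    (hd : 0 < d) (hk : k + n = Module.finrank F C₁ + Module.finrank F C₂ + c)
    (hc : c + Module.finrank F ↥(RationalAG.dual C₁ ⊓ C₂) =
      Module.finrank F (RationalAG.dual C₁))
    (h₁ : ∀ T : Finset (Fin n), T.card < d → ∀ x ∈ C₁, (∀ i, i ∉ T → x i = 0) → x = 0)
    (h₂ : ∀ T : Finset (Fin n), T.card < d → ∀ x ∈ C₂, (∀ i, i ∉ T → x i = 0) → x = 0) :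
    ∃ Q : Code F n k c, Q.DistGE d ∧ Q.IsEuclidean C₁ C₂ := by
  have hk' : k + Module.finrank F ↥(RationalAG.dual C₁ ⊓ C₂) = Module.finrank F C₂ := by
    have := RationalAG.finrank_add_finrank_dual C₁
    omega
  obtain ⟨M, hM, hMI, hMs⟩ := RationalAG.exists_parametrized_complement inf_le_left hc
  obtain ⟨L, hL, hLI, -⟩ := RationalAG.exists_parametrized_complement inf_le_right hk'
  let D : CosetData F n k c :=
    { I := RationalAG.dual C₁ ⊓ C₂
      L := L
      M := M
      indep := by
        intro x y h
        have hy : y = 0 := by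
          refine hMI y ⟨hM y, ?_⟩
          simpa using C₂.sub_mem h.2 (hL x)
        subst hy
        rw [map_zero, add_zero] at h
        exact ⟨hLI x h, rfl⟩ }
  have hdet : ∀ t, t < d → D.code.Detects t := by
    intro t ht
    refine D.detects ht (fun T hT x u hu h => h₂ T hT _ (C₂.add_mem (hL x) hu.2) h)
      fun T hT z => ?_
    obtain ⟨u, hu, huz⟩ := RationalAG.exists_mem_dual_eqOn (h₁ T hT) z
    obtain ⟨y, hy⟩ := hMs u hu
    exact ⟨y, u - M y, hy, fun i hi => by simpa [D] using huz i hi⟩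
  refine ⟨D.code, ⟨hdet, (hdet _ (by omega)).corrects⟩, ?_, ?_, hk, hc⟩
  · intro u hu
    obtain ⟨w, hw⟩ := hMs u hu
    exact ⟨w, D.shift_mul_encode hw⟩
  · intro χ v hv
    -- The receiver's phase cancels the phase `χ (v ⬝ᵥ M y)` on the physical qudits.
    let w := (dotProductEquiv F (Fin c)).symm (-(dotProductEquiv F (Fin n) v ∘ₗ M))
    refine ⟨w, D.phase_mul_encode χ (fun u hu => hv u hu.2) (fun x => hv _ (hL x)) fun y => ?_⟩
    have h : w ⬝ᵥ y = -(v ⬝ᵥ M y) := by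
      rw [← dotProductEquiv_apply_apply, LinearEquiv.apply_symm_apply]
      simp
    rw [h]
    exact add_neg_cancel _

end Construction

end Quenta

/-! ### Two-point codes on the rational function field are polynomial codes -/

namespace RationalAG

open WithZero

variable {F : Type*} [Field F]

theorem val_finitePlace_algebraMap_lt_one_iff (α : F) (p : F[X]) :
    val (finitePlace α) (algebraMap F[X] (RatFunc F) p) < 1 ↔ p.eval α = 0 := by
  rw [finitePlace, val, HeightOneSpectrum.valuation_lt_one_iff_mem, Ideal.mem_span_singleton,
    dvd_iff_isRoot, IsRoot.def]

/-- The principal divisor of `z`, tested on valuations. -/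
theorem val_X (P : Place F) : val P RatFunc.X = exp (-(twoPoint (1 : ℤ) (-1) P : ℤ)) := by
  classical
  cases P with
  | none =>
    rw [val, RatFunc.inftyValuation.X]
    simp [twoPoint, finitePlace, inftyPlace]
  | some p =>
    rw [val, ← RatFunc.algebraMap_X]
    by_cases h : finitePlace 0 = some p
    · have hp : p.asIdeal = Ideal.span {X} := by
        rw [← Option.some_injective _ h]
        change Ideal.span {X - C (0 : F)} = _
        rw [C_0, sub_zero]
      rw [HeightOneSpectrum.valuation_of_algebraMap,
        HeightOneSpectrum.intValuation_singleton _ X_ne_zero hp]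
      simp [twoPoint, h, inftyPlace]
    · have h1 : twoPoint (1 : ℤ) (-1) (some p) = 0 := by
        simp [twoPoint, inftyPlace, h]
      rw [h1, neg_zero, exp_zero]
      refine le_antisymm (p.valuation_le_one _) (not_lt.1 fun hlt => h ?_)
      rw [HeightOneSpectrum.valuation_lt_one_iff_mem] at hlt
      have hle : Ideal.span {X - C (0 : F)} ≤ p.asIdeal := by
        rw [Ideal.span_singleton_le_iff_mem, C_0, sub_zero]
        exact hlt
      have hmax : (Ideal.span {X - C (0 : F)}).IsMaximal :=
        PrincipalIdealRing.isMaximal_of_irreducible (irreducible_X_sub_C 0)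
      exact congrArg some (HeightOneSpectrum.ext (hmax.eq_of_le p.isPrime.ne_top hle))

/-- `L(m P_∞)` consists of the polynomials of degree at most `m`. -/
theorem mem_riemannRoch_single_inftyPlace_iff (m : ℕ) (f : RatFunc F) :
    f ∈ riemannRoch (Finsupp.single inftyPlace (m : ℤ)) ↔
      ∃ p : F[X], p.natDegree ≤ m ∧ f = algebraMap F[X] (RatFunc F) p := by
  classical
  have hinf : ∀ p : F[X], val none (algebraMap F[X] (RatFunc F) p) ≤ exp (m : ℤ) ↔
      p.natDegree ≤ m := by
    intro p
    rcases eq_or_ne p 0 with rfl | hp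
    · simp
    · rw [val, RatFunc.inftyValuation_apply, RatFunc.inftyValuation.polynomial _ hp, exp_le_exp,
        Nat.cast_le]
  constructor
  · intro h
    obtain ⟨p, rfl⟩ := HeightOneSpectrum.mem_integers_of_valuation_le_one (R := F[X])
      (RatFunc F) f fun p => by simpa [val, inftyPlace] using h (some p)
    refine ⟨p, (hinf p).1 ?_, rfl⟩
    simpa [inftyPlace] using h none
  · rintro ⟨p, hp, rfl⟩ (_ | v)
    · simpa [inftyPlace] using (hinf p).2 hp
    · simpa [inftyPlace, val] using v.valuation_le_one p

theorem mem_riemannRoch_twoPoint_iff (a b : ℕ) (f : RatFunc F) :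
    f ∈ riemannRoch (twoPoint (a : ℤ) (b : ℤ)) ↔
      ∃ p : F[X], p.natDegree ≤ a + b ∧ f * RatFunc.X ^ a = algebraMap F[X] (RatFunc F) p := by
  rw [← mem_riemannRoch_single_inftyPlace_iff]
  refine forall_congr' fun P => ?_
  have h : (Finsupp.single inftyPlace ((a + b : ℕ) : ℤ) : Divisor F) P =
      twoPoint (a : ℤ) (b : ℤ) P - a * twoPoint (1 : ℤ) (-1) P := by
    classical
    simp only [twoPoint, Finsupp.add_apply, Finsupp.single_apply]
    split_ifs <;> push_cast <;> ring
  rw [h, map_mul, map_pow, val_X, ← exp_nsmul, sub_eq_add_neg, exp_add, nsmul_eq_mul, mul_neg]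
  exact (mul_le_mul_iff_left₀ (by simp)).symm

/-- The words of `C_L(D, a P₀ + b P_∞)` are the evaluations of `z ^ (-a) * p` for polynomials `p` of
degree at most `a + b`. -/
theorem mem_agCode_twoPoint_iff {n : ℕ} {P : Fin n → F} (hP0 : ∀ i, P i ≠ 0) (a b : ℕ)
    (c : Fin n → F) :
    c ∈ agCode P (twoPoint (a : ℤ) (b : ℤ)) ↔
      ∃ p : F[X], p.natDegree ≤ a + b ∧ ∀ i, c i * P i ^ a = p.eval (P i) := by
  have key : ∀ (f : RatFunc F) (p : F[X]),
      f * RatFunc.X ^ a = algebraMap F[X] (RatFunc F) p → ∀ i,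
      (val (finitePlace (P i)) (f - RatFunc.C (c i)) < 1 ↔ c i * P i ^ a = p.eval (P i)) := by
    intro f p hfp i
    have hX : val (finitePlace (P i)) RatFunc.X = 1 := by
      refine le_antisymm ?_ (not_lt.1 fun h => hP0 i ?_)
      · rw [← RatFunc.algebraMap_X]
        exact HeightOneSpectrum.valuation_le_one _ _
      · rw [← RatFunc.algebraMap_X, val_finitePlace_algebraMap_lt_one_iff] at h
        simpa using h
    have h1 : val (finitePlace (P i)) (f - RatFunc.C (c i)) =
        val (finitePlace (P i)) (algebraMap F[X] (RatFunc F) (p - C (c i) * X ^ a)) := by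
      rw [map_sub (algebraMap _ _), ← hfp, map_mul (algebraMap _ _), map_pow (algebraMap _ _),
        RatFunc.algebraMap_X, RatFunc.algebraMap_C, ← sub_mul, map_mul, map_pow, hX, one_pow,
        mul_one]
    rw [h1, val_finitePlace_algebraMap_lt_one_iff, eval_sub, sub_eq_zero, eval_mul, eval_C,
      eval_pow, eval_X, eq_comm]
  constructor
  · rintro ⟨f, hf, hc⟩
    obtain ⟨p, hp, hfp⟩ := (mem_riemannRoch_twoPoint_iff a b f).1 hf
    exact ⟨p, hp, fun i => (key f p hfp i).1 (hc i)⟩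
  · rintro ⟨p, hp, hc⟩
    have hfp : algebraMap F[X] (RatFunc F) p / RatFunc.X ^ a * RatFunc.X ^ a
        = algebraMap F[X] (RatFunc F) p :=
      div_mul_cancel₀ _ (pow_ne_zero _ RatFunc.X_ne_zero)
    exact ⟨_, (mem_riemannRoch_twoPoint_iff a b _).2 ⟨p, hp, hfp⟩,
      fun i => (key _ p hfp i).2 (hc i)⟩

/-- A nonzero word of `C_L(D, a P₀ + b P_∞)` has weight at least `n - (a + b)`. -/
theorem eq_zero_of_mem_agCode_twoPoint {n : ℕ} {P : Fin n → F} (hP : Function.Injective P)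
    (hP0 : ∀ i, P i ≠ 0) {a b : ℕ} {T : Finset (Fin n)} (hT : T.card + (a + b) < n)
    {c : Fin n → F} (hc : c ∈ agCode P (twoPoint (a : ℤ) (b : ℤ))) (h : ∀ i, i ∉ T → c i = 0) :
    c = 0 := by
  obtain ⟨p, hp, hcp⟩ := (mem_agCode_twoPoint_iff hP0 a b c).1 hc
  have hp0 : p = 0 := by
    classical
    refine eq_zero_of_natDegree_lt_card_of_eval_eq_zero' p (Tᶜ.image P) ?_ ?_
    · intro x hx
      obtain ⟨i, hi, rfl⟩ := Finset.mem_image.1 hx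
      rw [← hcp, h i (Finset.mem_compl.1 hi), zero_mul]
    · rw [Finset.card_image_of_injective _ hP, Finset.card_compl, Fintype.card_fin]
      omega
  ext i
  have h1 := hcp i
  rw [hp0, eval_zero] at h1
  exact (mul_eq_zero.1 h1).resolve_right (pow_ne_zero _ (hP0 i))

end RationalAG

/-! ### The monomial basis and its orthogonality relations -/

namespace RationalAG

variable {F : Type*} [Field F] {n : ℕ} {P : Fin n → F}

open Classical in
/-- The basis of `F ^ n` formed by the evaluations of `1, z, …, z ^ (n - 1)` at `n` distinct
points. -/
noncomputable def monomialBasis (hP : Function.Injective P) :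
    Module.Basis (Fin n) F (Fin n → F) :=
  basisOfPiSpaceOfLinearIndependent
    (Matrix.linearIndependent_cols_of_det_ne_zero (Matrix.det_vandermonde_ne_zero_iff.2 hP))

theorem monomialBasis_apply (hP : Function.Injective P) (j i : Fin n) :
    monomialBasis hP j i = P i ^ (j : ℕ) := by
  rw [monomialBasis, coe_basisOfPiSpaceOfLinearIndependent]
  rfl

theorem finrank_span_basis_image {ι V : Type*} [AddCommGroup V] [Module F V]
    (b : Module.Basis ι F V) (s : Finset ι) :
    Module.finrank F (Submodule.span F (b '' (s : Set ι))) = s.card := by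
  rw [Set.image_eq_range]
  exact (finrank_span_eq_card (b.linearIndependent.comp _ Subtype.val_injective)).trans
    (Fintype.card_coe s)

theorem finrank_span_monomialBasis_Ioo (hP : Function.Injective P) {lo hi : ℕ} (h : hi ≤ n) :
    Module.finrank F (Submodule.span F
      (monomialBasis hP '' {j : Fin n | lo < (j : ℕ) ∧ (j : ℕ) < hi})) = hi - lo - 1 := by
  have h1 : {j : Fin n | lo < (j : ℕ) ∧ (j : ℕ) < hi} =
      ((Finset.univ.filter fun j : Fin n => lo < (j : ℕ) ∧ (j : ℕ) < hi : Finset (Fin n)) :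
        Set (Fin n)) := by
    ext; simp
  rw [h1, finrank_span_basis_image, ← Finset.card_map Fin.valEmbedding, ← Nat.card_Ioo]
  congr 1
  ext j
  simp only [Finset.mem_map, Finset.mem_filter, Finset.mem_univ, true_and, Fin.valEmbedding_apply,
    Finset.mem_Ioo]
  exact ⟨fun ⟨i, hi, hij⟩ => hij ▸ hi, fun hj => ⟨⟨j, by omega⟩, hj, rfl⟩⟩

variable [Fintype F]

theorem pow_eq_one_of_card (hn : n + 1 = Fintype.card F) (hP0 : ∀ i, P i ≠ 0) (i : Fin n) :
    P i ^ n = 1 := by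
  have h := FiniteField.pow_card_sub_one_eq_one (P i) (hP0 i)
  rwa [← hn, Nat.add_sub_cancel] at h

theorem sum_pow_eq (hn : n + 1 = Fintype.card F) (hP : Function.Injective P)
    (hP0 : ∀ i, P i ≠ 0) (l : ℕ) : ∑ i, P i ^ l = if n ∣ l then -1 else 0 := by
  classical
  have hbij : Function.Bijective fun i => Units.mk0 (P i) (hP0 i) := by
    rw [Fintype.bijective_iff_injective_and_card]
    refine ⟨fun i j h => hP (congrArg Units.val h), ?_⟩
    rw [Fintype.card_fin, Fintype.card_units, ← hn, Nat.add_sub_cancel]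
  have h := FiniteField.sum_pow_units F l
  rw [← hn, Nat.add_sub_cancel] at h
  rw [← h]
  exact hbij.sum_comp fun x : Fˣ => (x : F) ^ l

theorem pow_mem_span_monomialBasis (hn : n + 1 = Fintype.card F) (hP : Function.Injective P)
    (hP0 : ∀ i, P i ≠ 0) {s : Set (Fin n)} {l : ℕ} (j : Fin n) (hj : j ∈ s)
    (hl : (j : ℕ) = l ∨ j + n = l) :
    (fun i => P i ^ l) ∈ Submodule.span F (monomialBasis hP '' s) := by
  refine Submodule.subset_span ⟨j, hj, funext fun i => ?_⟩
  rw [monomialBasis_apply]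
  rcases hl with rfl | rfl
  · rfl
  · rw [pow_add, pow_eq_one_of_card hn hP0, mul_one]

/-- The two-point code is spanned by the monomials `z ^ j`, `-a ≤ j ≤ b`, with exponents read modulo
`n = q - 1`. -/
theorem agCode_twoPoint_eq_span (hn : n + 1 = Fintype.card F) (hP : Function.Injective P)
    (hP0 : ∀ i, P i ≠ 0) {a b : ℕ} (hab : a + b < n) :
    agCode P (twoPoint (a : ℤ) (b : ℤ)) =
      Submodule.span F (monomialBasis hP '' {j : Fin n | (j : ℕ) ≤ b ∨ n ≤ j + a}) := by
  have h1 := pow_eq_one_of_card hn hP0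
  refine le_antisymm (fun c hc => ?_) (Submodule.span_le.2 ?_)
  · obtain ⟨p, hp, hcp⟩ := (mem_agCode_twoPoint_iff hP0 a b c).1 hc
    have hce : c = ∑ m ∈ Finset.range (a + b + 1), p.coeff m • fun i => P i ^ (m + (n - a)) := by
      ext i
      have h2 : c i = c i * P i ^ a * P i ^ (n - a) := by
        rw [mul_assoc, ← pow_add, Nat.add_sub_cancel' (by omega), h1, mul_one]
      rw [h2, hcp, eval_eq_sum_range' (Nat.lt_succ_of_le hp), Finset.sum_mul, Finset.sum_apply]
      exact Finset.sum_congr rfl fun m _ => by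
        rw [Pi.smul_apply, smul_eq_mul, pow_add, mul_assoc]
    rw [hce]
    refine Submodule.sum_mem _ fun m hm => Submodule.smul_mem _ _ ?_
    rw [Finset.mem_range] at hm
    by_cases hma : m < a
    · exact pow_mem_span_monomialBasis hn hP hP0 ⟨m + (n - a), by omega⟩
        (Or.inr (by simp only; omega)) (Or.inl rfl)
    · exact pow_mem_span_monomialBasis hn hP hP0 ⟨m - a, by omega⟩
        (Or.inl (by simp only; omega)) (Or.inr (by simp only; omega))
  · rintro _ ⟨j, hj, rfl⟩
    refine (mem_agCode_twoPoint_iff hP0 a b _).2 ?_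
    simp only [monomialBasis_apply]
    rcases hj with hj | hj
    · exact ⟨X ^ ((j : ℕ) + a), by rw [natDegree_X_pow]; omega, fun i => by
        rw [eval_pow, eval_X, pow_add]⟩
    · refine ⟨X ^ ((j : ℕ) + a - n), by rw [natDegree_X_pow]; omega, fun i => ?_⟩
      rw [eval_pow, eval_X, ← pow_add, ← mul_one (P i ^ ((j : ℕ) + a - n)), ← h1 i, ← pow_add,
        Nat.sub_add_cancel hj]

/-- The orthogonality relations: pairing with the monomial of exponent `m` reads off the coordinate
of exponent `-m` modulo `n`. -/
theorem dotProduct_monomialBasis (hn : n + 1 = Fintype.card F) (hP : Function.Injective P)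
    (hP0 : ∀ i, P i ≠ 0) {m l : Fin n} (hml : n ∣ (l : ℕ) + m) (x : Fin n → F) :
    x ⬝ᵥ monomialBasis hP m = -(monomialBasis hP).repr x l := by
  have h1 : ∀ j : Fin n, monomialBasis hP j ⬝ᵥ monomialBasis hP m = if j = l then -1 else 0 := by
    intro j
    simp only [dotProduct, monomialBasis_apply, ← pow_add]
    rw [sum_pow_eq hn hP hP0]
    refine if_congr ⟨fun h => ?_, fun h => h ▸ hml⟩ rfl rfl
    have h2 : (j : ℕ) ≡ l [MOD n] :=
      Nat.ModEq.add_right_cancel' (m : ℕ) ((Nat.modEq_zero_iff_dvd.2 h).trans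
        (Nat.modEq_zero_iff_dvd.2 hml).symm)
    exact Fin.ext (h2.eq_of_lt_of_lt j.2 l.2)
  conv_lhs => rw [← (monomialBasis hP).sum_repr x]
  rw [sum_dotProduct]
  simp [smul_dotProduct, h1]

/-- The dual of a two-point code is spanned by the complementary monomials, with exponents
negated. -/
theorem dual_agCode_twoPoint_eq_span (hn : n + 1 = Fintype.card F) (hP : Function.Injective P)
    (hP0 : ∀ i, P i ≠ 0) {a b : ℕ} (hab : a + b < n) :
    dual (agCode P (twoPoint (a : ℤ) (b : ℤ))) =
      Submodule.span F (monomialBasis hP '' {j : Fin n | a < (j : ℕ) ∧ j + b < n}) := by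
  rw [agCode_twoPoint_eq_span hn hP hP0 hab]
  ext x
  rw [Module.Basis.mem_span_image]
  constructor
  · intro hx l hl
    rw [Finset.mem_coe, Finsupp.mem_support_iff] at hl
    by_contra hlS
    refine hl ?_
    have key : ∀ m : Fin n, n ∣ (l : ℕ) + m → ((m : ℕ) ≤ b ∨ n ≤ m + a) →
        (monomialBasis hP).repr x l = 0 := by
      intro m hml hm
      have h1 := hx _ (Submodule.subset_span ⟨m, hm, rfl⟩)
      rwa [dotProduct_monomialBasis hn hP hP0 hml, neg_eq_zero] at h1
    simp only [Set.mem_ofPred_eq, not_and, not_lt] at hlS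
    have hl2 := l.2
    rcases Nat.eq_zero_or_pos (l : ℕ) with h0 | h0
    · exact key l (by rw [h0]; exact dvd_zero n) (Or.inl (by omega))
    · refine key ⟨n - l, by omega⟩ (by simp only; rw [Nat.add_sub_cancel' hl2.le]) ?_
      simp only
      omega
  · intro hx c hc
    induction hc using Submodule.span_induction with
    | mem c hc =>
      obtain ⟨m, hm, rfl⟩ := hc
      have key : ∀ l : Fin n, n ∣ (l : ℕ) + m → ¬(a < (l : ℕ) ∧ l + b < n) →
          x ⬝ᵥ monomialBasis hP m = 0 := by
        intro l hml hl
        rw [dotProduct_monomialBasis hn hP hP0 hml, neg_eq_zero]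
        by_contra h
        exact hl (hx (Finset.mem_coe.2 (Finsupp.mem_support_iff.2 h)))
      have hm2 := m.2
      simp only [Set.mem_ofPred_eq] at hm
      rcases Nat.eq_zero_or_pos (m : ℕ) with h0 | h0
      · exact key m (by rw [h0]; exact dvd_zero n) (by omega)
      · refine key ⟨n - m, by omega⟩ (by simp only; rw [Nat.sub_add_cancel hm2.le]) ?_
        simp only
        omega
    | zero => exact dotProduct_zero x
    | add c c' _ _ h h' => rw [dotProduct_add, h, h', add_zero]
    | smul r c _ h => rw [dotProduct_smul, h, smul_zero]

theorem finrank_dual_agCode_twoPoint (hn : n + 1 = Fintype.card F) (hP : Function.Injective P)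
    (hP0 : ∀ i, P i ≠ 0) {a b : ℕ} (hab : a + b < n) :
    Module.finrank F (dual (agCode P (twoPoint (a : ℤ) (b : ℤ)))) = n - b - a - 1 := by
  have h : {j : Fin n | a < (j : ℕ) ∧ j + b < n} = {j : Fin n | a < (j : ℕ) ∧ (j : ℕ) < n - b} := by
    ext j
    simp only [Set.mem_ofPred_eq]
    omega
  rw [dual_agCode_twoPoint_eq_span hn hP hP0 hab, h,
    finrank_span_monomialBasis_Ioo hP (Nat.sub_le n b)]

theorem finrank_agCode_twoPoint (hn : n + 1 = Fintype.card F) (hP : Function.Injective P)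
    (hP0 : ∀ i, P i ≠ 0) {a b : ℕ} (hab : a + b < n) :
    Module.finrank F (agCode P (twoPoint (a : ℤ) (b : ℤ))) = a + b + 1 := by
  have h1 := finrank_add_finrank_dual (agCode P (twoPoint (a : ℤ) (b : ℤ)))
  rw [finrank_dual_agCode_twoPoint hn hP hP0 hab] at h1
  omega

/-- For these parameters the exponents `-b₁, …, -1` of the second code are outside the dual of the
first, so the intersection is spanned by the `z ^ j` with `a₁ < j ≤ b₂`. -/
theorem finrank_dual_inf_agCode_twoPoint (hn : n + 1 = Fintype.card F)
    (hP : Function.Injective P) (hP0 : ∀ i, P i ≠ 0) {a₁ a₂ b₁ b₂ : ℕ} (ha : a₁ + a₂ < n)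
    (hb : b₁ + b₂ < n) (hba : b₁ ≤ a₂) (hbn : b₂ + a₂ < n) :
    Module.finrank F ↥(dual (agCode P (twoPoint (a₁ : ℤ) (a₂ : ℤ))) ⊓
      agCode P (twoPoint (b₁ : ℤ) (b₂ : ℤ))) = b₂ - a₁ := by
  have h : dual (agCode P (twoPoint (a₁ : ℤ) (a₂ : ℤ))) ⊓ agCode P (twoPoint (b₁ : ℤ) (b₂ : ℤ)) =
      Submodule.span F (monomialBasis hP '' {j : Fin n | a₁ < (j : ℕ) ∧ (j : ℕ) < b₂ + 1}) := by
    rw [dual_agCode_twoPoint_eq_span hn hP hP0 ha, agCode_twoPoint_eq_span hn hP hP0 hb]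
    ext x
    rw [Submodule.mem_inf, Module.Basis.mem_span_image, Module.Basis.mem_span_image,
      Module.Basis.mem_span_image, ← Set.subset_inter_iff]
    refine iff_of_eq (congrArg _ ?_)
    ext j
    simp only [Set.mem_inter_iff, Set.mem_ofPred_eq]
    omega
  rw [h, finrank_span_monomialBasis_Ioo hP (by omega)]
  omega

end RationalAG

/-! ### Existence and parameters of the quantum codes -/

theorem mainTheorem2 {F : Type*} [Field F] [Fintype F] [DecidableEq F]
    (q : ℕ) (hq : Fintype.card F = q)
    (P : Fin (q - 1) → F) (hP : Function.Injective P) (hP0 : ∀ i, P i ≠ 0)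
    (a₁ a₂ b₁ b₂ : ℕ) (ha₁ : 0 < a₁) (ha₂ : 0 < a₂) (hb₁ : 0 < b₁) (hb₂ : 0 < b₂)
    (hba : b₁ ≤ a₂) (hbq : b₂ ≤ q - 2 - a₂) (ha : a₁ + a₂ < q - 1) (hb : b₁ + b₂ < q - 1) :
    (a₁ + 1 ≤ b₂ →
      ∃ Q : Quenta.Code F (q - 1) (a₁ + b₁ + 1) (q - 2 - (a₂ + b₂)),
        Q.DistGE (q - 1 - max (a₁ + a₂) (b₁ + b₂)) ∧
        Q.IsEuclidean (RationalAG.agCode P (RationalAG.twoPoint a₁ a₂))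
          (RationalAG.agCode P (RationalAG.twoPoint b₁ b₂))) ∧
    (b₂ < a₁ + 1 →
      ∃ Q : Quenta.Code F (q - 1) (b₁ + b₂ + 1) (q - 2 - (a₁ + a₂)),
        Q.DistGE (q - 1 - max (a₁ + a₂) (b₁ + b₂)) ∧
        Q.IsEuclidean (RationalAG.agCode P (RationalAG.twoPoint a₁ a₂))
          (RationalAG.agCode P (RationalAG.twoPoint b₁ b₂))) := by
  have hn : q - 1 + 1 = Fintype.card F := by omega
  have hf₁ := RationalAG.finrank_agCode_twoPoint hn hP hP0 ha
  have hf₂ := RationalAG.finrank_agCode_twoPoint hn hP hP0 hb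
  have hd := RationalAG.finrank_dual_agCode_twoPoint hn hP hP0 ha
  have hi := RationalAG.finrank_dual_inf_agCode_twoPoint hn hP hP0 ha hb hba (by omega)
  have key : ∀ k c, k + (q - 1) = (a₁ + a₂ + 1) + (b₁ + b₂ + 1) + c →
      c + (b₂ - a₁) = q - 1 - a₂ - a₁ - 1 →
      ∃ Q : Quenta.Code F (q - 1) k c,
        Q.DistGE (q - 1 - max (a₁ + a₂) (b₁ + b₂)) ∧
        Q.IsEuclidean (RationalAG.agCode P (RationalAG.twoPoint a₁ a₂))
          (RationalAG.agCode P (RationalAG.twoPoint b₁ b₂)) := by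
    intro k c hk hc
    refine Quenta.exists_isEuclidean_distGE (by omega) (by rw [hf₁, hf₂, hk])
      (by rw [hi, hd, hc]) (fun T hT x hx h => ?_) (fun T hT x hx h => ?_)
    · exact RationalAG.eq_zero_of_mem_agCode_twoPoint hP hP0 (by omega) hx h
    · exact RationalAG.eq_zero_of_mem_agCode_twoPoint hP hP0 (by omega) hx h
  exact ⟨fun h => key _ _ (by omega) (by omega), fun h => key _ _ (by omega) (by omega)⟩
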